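/- For a graph $G$ with adjacency matrix $A$, degree matrix $\Delta$ and Laplacian $L=\Delta-A$, and a non-zero real number $q$, the $q$-Laplacian matrix of $G$ is $$\mathscr{L}=qL-(q-1)I+q(q-1)(\Delta-I),$$ and $U_{\mathscr L}(t)=\exp(it\mathscr L)$ for $t\in\mathbb R$. There is $q$-Laplacian perfect vertex state transfer between vertices $a$ and $b$ at time $\tau>0$ if $\mathbf e_b\mathbf e_b^T=U_{\mathscr L}(\tau)\,\mathbf e_a\mathbf e_a^T\,U_{\mathscr L}(-\tau)$. Let $P_n$ be the (unweighted) path on $n\ge 2$ vertices. 1. There is a real $q\neq 0$ such that $P_n$ has $q$-Laplacian perfect vertex state transfer between its end vertices at some time if and only if $n=2$ or $n=3$. 2. For $n=2$ and every real $q\ne 0$, perfect state transfer occurs between the end vertices at time $\frac{\pi}{2|q|}$. 3. For $n=3$ and real $q\neq0$, perfect state transfer occurs between the end vertices at some time if and only if $$|q|=\sqrt{\frac{8l^2}{k^2-l^2}}$$ for some integers $k>l>0$ with $k\not\equiv l \pmod 2$. Moreover, for real $q\ne0$ and real $\tau$, it occurs at time $\tau$ if and only if there are such $k,l$ with $|q|=\sqrt{\frac{8l^2}{k^2-l^2}}$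 and $\tau=\frac{\pi(k^2-l^2)}{4l}$. -/

import Mathlib

open Real Matrix

instance pathGraphDecidableAdj (n : ℕ) : DecidableRel (SimpleGraph.pathGraph n).Adj :=
  fun _ _ => decidable_of_iff' _ SimpleGraph.pathGraph_adj

noncomputable section

/-- The `q`-Laplacian matrix `q L - (q - 1) I + q (q - 1) (Δ - I)` of a graph (all edges of
weight one), where `L = Δ - A` is the Laplacian and `Δ` is the degree matrix. -/
def qLaplacian {V : Type*} [Fintype V] [DecidableEq V] (G : SimpleGraph V) [DecidableRel G.Adj]
    (q : ℝ) : Matrix V V ℝ :=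
  q • G.lapMatrix ℝ - (q - 1) • (1 : Matrix V V ℝ) + (q * (q - 1)) • (G.degMatrix ℝ - 1)

/-- The transition matrix `U(t) = exp (i t M)` of the continuous-time quantum walk with respect
to a real matrix `M`. -/
def transitionMatrix {V : Type*} [Fintype V] [DecidableEq V] (M : Matrix V V ℝ) (t : ℝ) :
    Matrix V V ℂ :=
  NormedSpace.exp ((Complex.I * (t : ℂ)) • M.map (fun r : ℝ => (r : ℂ)))

/-- The density matrix `D_x = x xᵀ` of a real vector state `x`. -/
def densityMatrix {V : Type*} (x : V → ℝ) : Matrix V V ℂ :=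
  (vecMulVec x x).map (fun r : ℝ => (r : ℂ))

/-- Perfect state transfer relative to `M` from the density matrix `D₁` to the density matrix
`D₂` at the (positive) time `τ`. -/
def IsPST {V : Type*} [Fintype V] [DecidableEq V] (M : Matrix V V ℝ) (D₁ D₂ : Matrix V V ℂ)
    (τ : ℝ) : Prop :=
  0 < τ ∧ D₂ = transitionMatrix M τ * D₁ * transitionMatrix M (-τ)

/-- `q`-Laplacian perfect vertex state transfer in `G` between the vertices `a` and `b` at
time `τ`. -/
def IsVertexPST {V : Type*} [Fintype V] [DecidableEq V] (G : SimpleGraph V) [DecidableRel G.Adj]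
    (q : ℝ) (a b : V) (τ : ℝ) : Prop :=
  IsPST (qLaplacian G q) (densityMatrix (Pi.single a 1)) (densityMatrix (Pi.single b 1)) τ

end

/-! Expanding gives `q²(Δ - 1) + 1 - qA`. On a path this equals `(1 + q²) - qB`, where `B` is the
adjacency matrix with a loop of weight `q` at each end, so an eigenvalue `θ` of `B` gives the
eigenvalue `1 + q² - qθ`. Transfer between the ends forces a phase ratio `-1` between symmetric and
antisymmetric eigenvectors. Hence every symmetric `θ` and antisymmetric `η` differ by an odd
multiple of one fixed `δ`.

For `n ≥ 4` this is impossible. The product of all the differences is a resultant, computed from the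
three-term recurrence to be a power of 2 up to sign. Comparing low-order coefficients of the two
factors shows that 2 is an integer multiple of `δ` (`n` even) or of `δ²` (`n` odd). The 2-adic
valuation of `δ`, respectively `δ²`, would then be an integer strictly between 0 and 1
(`two_adic_contradiction`).

For `n = 2, 3` the spectrum is explicit, and matching phases on an eigenvector decomposition of the
end vertices is also sufficient (`isPST_of_eigenvectors`). -/

theorem Matrix.exp_mulVec_of_mulVec_eq_smul {V : Type*} [Fintype V] [DecidableEq V]
    {A : Matrix V V ℂ} {v : V → ℂ} {c : ℂ} (h : A *ᵥ v = c • v) :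
    NormedSpace.exp A *ᵥ v = Complex.exp c • v := by
  let _ : NormedRing (Matrix V V ℂ) := Matrix.linftyOpNormedRing
  let _ : NormedAlgebra ℂ (Matrix V V ℂ) := Matrix.linftyOpNormedAlgebra
  have hpow : ∀ n : ℕ, A ^ n *ᵥ v = c ^ n • v := by
    intro n
    induction n with
    | zero => simp
    | succ n ih => rw [pow_succ, ← mulVec_mulVec, h, mulVec_smul, ih, smul_smul, pow_succ']
  have h1 := NormedSpace.exp_series_hasSum_exp' (𝕂 := ℂ) A
  have h2 := NormedSpace.exp_series_hasSum_exp' (𝕂 := ℂ) c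
  rw [← Complex.exp_eq_exp_ℂ] at h2
  let Φ : Matrix V V ℂ →ₗ[ℂ] (V → ℂ) :=
    { toFun := fun B => B *ᵥ v
      map_add' := fun B C => add_mulVec B C v
      map_smul' := fun r B => smul_mulVec r B v }
  have h3 := h1.map Φ Φ.continuous_of_finiteDimensional
  have h4 := h2.smul_const v
  refine h3.unique ?_
  convert h4 using 2 with n
  simp [Φ, smul_mulVec, hpow, smul_smul]

/-! ### Eigenvectors and state transfer -/

theorem transitionMatrix_mulVec {V : Type*} [Fintype V] [DecidableEq V] {M : Matrix V V ℝ}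
    {v : V → ℂ} {c : ℂ} (h : M.map (fun r : ℝ => (r : ℂ)) *ᵥ v = c • v) (t : ℝ) :
    transitionMatrix M t *ᵥ v = Complex.exp (Complex.I * t * c) • v :=
  Matrix.exp_mulVec_of_mulVec_eq_smul (by rw [smul_mulVec, h, smul_smul])

theorem transitionMatrix_transpose {V : Type*} [Fintype V] [DecidableEq V] {M : Matrix V V ℝ}
    (hM : M.IsSymm) (t : ℝ) : (transitionMatrix M t)ᵀ = transitionMatrix M t := by
  rw [transitionMatrix, ← Matrix.exp_transpose, transpose_smul, ← transpose_map, hM.eq]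

theorem transitionMatrix_vecMul {V : Type*} [Fintype V] [DecidableEq V] {M : Matrix V V ℝ}
    (hM : M.IsSymm) {v : V → ℂ} {c : ℂ} (h : M.map (fun r : ℝ => (r : ℂ)) *ᵥ v = c • v) (t : ℝ) :
    v ᵥ* transitionMatrix M t = Complex.exp (Complex.I * t * c) • v := by
  rw [← mulVec_transpose, transitionMatrix_transpose hM, transitionMatrix_mulVec h]

theorem densityMatrix_single {V : Type*} [DecidableEq V] (a : V) :
    densityMatrix (Pi.single a 1) = vecMulVec (Pi.single a (1 : ℂ)) (Pi.single a 1) := by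
  ext i j
  simp only [densityMatrix, vecMulVec_apply, Pi.single_apply, map_apply]
  split_ifs <;> simp

theorem qLaplacian_isSymm {V : Type*} [Fintype V] [DecidableEq V] (G : SimpleGraph V)
    [DecidableRel G.Adj] (q : ℝ) : (qLaplacian G q).IsSymm := by
  unfold qLaplacian
  exact (((G.isSymm_lapMatrix (R := ℝ)).smul q).sub (isSymm_one.smul _)).add
    (((G.isSymm_degMatrix (R := ℝ)).sub isSymm_one).smul _)

/-- Pairing the defining identity of perfect state transfer with an eigenvector. -/
theorem IsPST.smul_single_eq {V : Type*} [Fintype V] [DecidableEq V] {M : Matrix V V ℝ}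
    (hM : M.IsSymm) {a b : V} {τ : ℝ}
    (h : IsPST M (densityMatrix (Pi.single a 1)) (densityMatrix (Pi.single b 1)) τ)
    {v : V → ℂ} {c : ℂ} (hv : M.map (fun r : ℝ => (r : ℂ)) *ᵥ v = c • v) :
    v b = Complex.exp (Complex.I * τ * c) * v a * transitionMatrix M (-τ) a b := by
  have h2 := congrArg (fun N => (v ᵥ* N) b) h.2
  simp only [densityMatrix_single, ← vecMul_vecMul, transitionMatrix_vecMul hM hv] at h2
  simpa [vecMul_vecMulVec, smul_vecMul, mul_assoc] using h2

/-- Both pairings contain the same unknown entry of the transition matrix, which is nonzero;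
eliminating it leaves the ratio of the two phases. -/
theorem IsPST.exp_eq_neg_one {V : Type*} [Fintype V] [DecidableEq V] {M : Matrix V V ℝ}
    (hM : M.IsSymm) {a b : V} {τ : ℝ}
    (h : IsPST M (densityMatrix (Pi.single a 1)) (densityMatrix (Pi.single b 1)) τ)
    {v w : V → ℂ} {c d : ℂ} (hv : M.map (fun r : ℝ => (r : ℂ)) *ᵥ v = c • v)
    (hw : M.map (fun r : ℝ => (r : ℂ)) *ᵥ w = d • w)
    (hva : v a = 1) (hvb : v b = 1) (hwa : w a = 1) (hwb : w b = -1) :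
    Complex.exp (Complex.I * τ * (c - d)) = -1 := by
  have h1 := h.smul_single_eq hM hv
  have h2 := h.smul_single_eq hM hw
  rw [hva, hvb] at h1
  rw [hwa, hwb] at h2
  rw [mul_sub, Complex.exp_sub, div_eq_iff (Complex.exp_ne_zero _)]
  have hr : transitionMatrix M (-τ) a b ≠ 0 := by
    intro h0
    simp [h0] at h1
  apply mul_right_cancel₀ hr
  linear_combination -h1 - h2

/-- The hypotheses give `U(τ) e_a = γ e_b`, and the global phase `γ` cancels in the density matrix.
-/
theorem isPST_of_eigenvectors {V ι : Type*} [Fintype V] [DecidableEq V] [Fintype ι]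
    {M : Matrix V V ℝ} (hM : M.IsSymm) {a b : V} {τ : ℝ} (hτ : 0 < τ)
    (x : ι → V → ℂ) (c ε : ι → ℂ) (γ : ℂ) (hγ : γ ≠ 0)
    (hx : ∀ i, M.map (fun r : ℝ => (r : ℂ)) *ᵥ x i = c i • x i)
    (hε : ∀ i, ε i ^ 2 = 1)
    (hc : ∀ i, Complex.exp (Complex.I * τ * c i) = γ * ε i)
    (ha : ∑ i, x i = Pi.single a 1) (hb : ∑ i, ε i • x i = Pi.single b 1) :
    IsPST M (densityMatrix (Pi.single a 1)) (densityMatrix (Pi.single b 1)) τ := by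
  have h1 : transitionMatrix M τ *ᵥ Pi.single a 1 = γ • Pi.single b 1 := by
    rw [← ha, ← hb, mulVec_sum, Finset.smul_sum]
    refine Finset.sum_congr rfl fun i _ => ?_
    rw [transitionMatrix_mulVec (hx i), hc, smul_smul]
  have h2 : Pi.single a 1 ᵥ* transitionMatrix M (-τ) = γ⁻¹ • Pi.single b 1 := by
    rw [← mulVec_transpose, transitionMatrix_transpose hM, ← ha, ← hb, mulVec_sum, Finset.smul_sum]
    refine Finset.sum_congr rfl fun i _ => ?_
    rw [transitionMatrix_mulVec (hx i), smul_smul]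
    congr 1
    have h3 := hc i
    have h4 : Complex.I * ((-τ : ℝ) : ℂ) * c i = -(Complex.I * τ * c i) := by push_cast; ring
    rw [h4, Complex.exp_neg, h3, mul_inv]
    congr 1
    rw [inv_eq_iff_eq_inv]
    exact eq_inv_of_mul_eq_one_left (by rw [← sq, hε])
  refine ⟨hτ, ?_⟩
  rw [densityMatrix_single, densityMatrix_single, mul_vecMulVec, vecMulVec_mul, h1, h2,
    vecMulVec_smul, smul_vecMulVec, smul_smul, inv_mul_cancel₀ hγ, one_smul]

/-! ### Eigenvectors of the path and their reflection symmetry -/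

theorem qLaplacian_mulVec_apply {V : Type*} [Fintype V] [DecidableEq V] (G : SimpleGraph V)
    [DecidableRel G.Adj] (q : ℝ) (v : V → ℂ) (i : V) :
    ((qLaplacian G q).map (fun r : ℝ => (r : ℂ)) *ᵥ v) i =
      ((q : ℂ) ^ 2 * ((∑ j, if G.Adj i j then (1 : ℂ) else 0) - 1) + 1) * v i
        - q * ∑ j, if G.Adj i j then v j else 0 := by
  have h1 : (qLaplacian G q).map (fun r : ℝ => (r : ℂ)) =
      ((q : ℂ) ^ 2) • (G.degMatrix ℂ - 1) + 1 - (q : ℂ) • G.adjMatrix ℂ := by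
    ext i j
    by_cases hij : i = j
    · subst hij
      simp [qLaplacian, SimpleGraph.lapMatrix, SimpleGraph.degMatrix]
      ring
    · by_cases hadj : G.Adj i j <;>
        simp [qLaplacian, SimpleGraph.lapMatrix, SimpleGraph.degMatrix, hij, hadj]
  rw [h1, sub_mulVec, add_mulVec, smul_mulVec, smul_mulVec, sub_mulVec, one_mulVec]
  simp only [Pi.sub_apply, Pi.add_apply, Pi.smul_apply, smul_eq_mul,
    SimpleGraph.degMatrix_mulVec_apply, SimpleGraph.adjMatrix_mulVec_apply,
    SimpleGraph.neighborFinset_eq_filter, Finset.sum_filter, ← SimpleGraph.degree_eq_sum_if_adj]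
  ring

theorem sum_pathGraph_adj {n : ℕ} (g : ℕ → ℂ) (i : Fin n) :
    (∑ j, if (SimpleGraph.pathGraph n).Adj i j then g j else 0) =
      (if (i : ℕ) + 1 < n then g (i + 1) else 0) + (if 0 < (i : ℕ) then g (i - 1) else 0) := by
  simp only [SimpleGraph.pathGraph_adj]
  rw [Fin.sum_univ_eq_sum_range (fun j => if (i : ℕ) + 1 = j ∨ j + 1 = (i : ℕ) then g j else 0)]
  have h : ∀ j ∈ Finset.range n, (if (i : ℕ) + 1 = j ∨ j + 1 = (i : ℕ) then g j else 0) =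
      (if (i : ℕ) + 1 = j then g j else 0) +
        (if (i : ℕ) - 1 = j then (if 0 < (i : ℕ) then g j else 0) else 0) := by
    intro j _
    split_ifs <;> first | omega | simp
  rw [Finset.sum_congr rfl h, Finset.sum_add_distrib, Finset.sum_ite_eq, Finset.sum_ite_eq]
  have := i.2
  simp only [Finset.mem_range]
  congr 1
  rw [if_pos (by omega)]

theorem qLaplacian_pathGraph_mulVec {n : ℕ} (hn : 2 ≤ n) (q : ℝ) (g : ℕ → ℂ) (θ : ℂ)
    (h0 : g 1 = (θ - q) * g 0)
    (hmid : ∀ k, k + 2 < n → g (k + 2) + g k = θ * g (k + 1))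
    (hlast : g (n - 2) = (θ - q) * g (n - 1)) :
    (qLaplacian (SimpleGraph.pathGraph n) q).map (fun r : ℝ => (r : ℂ)) *ᵥ
      (fun i : Fin n => g i) = (1 + (q : ℂ) ^ 2 - q * θ) • (fun i : Fin n => g i) := by
  ext i
  rw [qLaplacian_mulVec_apply, sum_pathGraph_adj g, sum_pathGraph_adj (fun _ => 1)]
  obtain ⟨i, hi⟩ := i
  simp only [Pi.smul_apply, smul_eq_mul]
  rcases Nat.eq_zero_or_pos i with rfl | hpos
  · have h1n : 0 + 1 < n := by omega
    rw [if_pos h1n, if_pos h1n, if_neg (lt_irrefl 0), if_neg (lt_irrefl 0), zero_add, h0]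
    ring
  · rw [if_pos hpos, if_pos hpos]
    by_cases hl : i + 1 < n
    · rw [if_pos hl, if_pos hl]
      obtain ⟨k, rfl⟩ : ∃ k, i = k + 1 := ⟨i - 1, by omega⟩
      have := hmid k (by omega)
      rw [show k + 1 + 1 = k + 2 from rfl, show k + 1 - 1 = k from rfl]
      linear_combination -(q : ℂ) * this
    · rw [if_neg hl, if_neg hl]
      obtain rfl : i = n - 1 := by omega
      rw [show n - 1 - 1 = n - 2 by omega, hlast]
      ring

/-- The characteristic polynomial of the path on `n` vertices with a loop of weight `q` at one
end. -/
noncomputable def loopedPathPoly (q : ℂ) : ℕ → Polynomial ℂ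
  | 0 => 1
  | 1 => Polynomial.X - Polynomial.C q
  | n + 2 => Polynomial.X * loopedPathPoly q (n + 1) - loopedPathPoly q n

theorem isMonicOfDegree_loopedPathPoly (q : ℂ) (n : ℕ) :
    Polynomial.IsMonicOfDegree (loopedPathPoly q n) n := by
  induction n using Nat.twoStepInduction with
  | zero => simp [loopedPathPoly, Polynomial.isMonicOfDegree_zero_iff]
  | one => exact Polynomial.isMonicOfDegree_X_sub_one q
  | more n ih1 ih2 =>
    have h := (Polynomial.isMonicOfDegree_X ℂ).mul ih2
    rw [show 1 + (n + 1) = n + 2 by ring] at h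
    exact h.sub (by rw [ih1.natDegree_eq]; omega)

/-- The recurrence is invariant under reversal, so a reflection relation at two adjacent indices
propagates outwards from the middle. -/
theorem eval_loopedPathPoly_reflect {q θ ε : ℂ} {p p' : ℕ}
    (h1 : (loopedPathPoly q p).eval θ = ε * (loopedPathPoly q (p' + 1)).eval θ)
    (h2 : (loopedPathPoly q (p + 1)).eval θ = ε * (loopedPathPoly q p').eval θ) (j : ℕ)
    (hj : j ≤ p') :
    (loopedPathPoly q (p + j)).eval θ = ε * (loopedPathPoly q (p' - j + 1)).eval θ ∧
      (loopedPathPoly q (p + j + 1)).eval θ = ε * (loopedPathPoly q (p' - j)).eval θ := by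
  induction j with
  | zero => exact ⟨h1, h2⟩
  | succ j ih =>
    obtain ⟨i1, i2⟩ := ih (by omega)
    obtain ⟨l, hl⟩ : ∃ l, p' - j = l + 1 := ⟨p' - j - 1, by omega⟩
    rw [show p' - (j + 1) = l by omega]
    rw [hl] at i1 i2
    refine ⟨i2, ?_⟩
    rw [show p + (j + 1) + 1 = p + j + 2 by ring]
    simp only [loopedPathPoly, Polynomial.eval_sub, Polynomial.eval_mul, Polynomial.eval_X]
      at i1 ⊢
    linear_combination θ * i2 - i1

/-- The recurrence already handles the first and interior vertices; reflection turns the condition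
at the last vertex into the one at the first. -/
theorem exists_eigenvector_of_reflect {n p p' : ℕ} (hn : p + p' + 2 = n) {q : ℝ} {θ ε : ℂ}
    (h1 : (loopedPathPoly q p).eval θ = ε * (loopedPathPoly q (p' + 1)).eval θ)
    (h2 : (loopedPathPoly q (p + 1)).eval θ = ε * (loopedPathPoly q p').eval θ) :
    ∃ v : Fin n → ℂ, (qLaplacian (SimpleGraph.pathGraph n) q).map (fun r : ℝ => (r : ℂ)) *ᵥ v =
      (1 + (q : ℂ) ^ 2 - q * θ) • v ∧ v ⟨0, by omega⟩ = 1 ∧ v ⟨n - 1, by omega⟩ = ε := by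
  obtain ⟨e1, e2⟩ := eval_loopedPathPoly_reflect h1 h2 p' le_rfl
  refine ⟨fun i => (loopedPathPoly q i).eval θ,
    qLaplacian_pathGraph_mulVec (by omega) q (fun k => (loopedPathPoly q k).eval θ) θ ?_ ?_ ?_,
    ?_, ?_⟩
  · simp [loopedPathPoly]
  · intro k _
    simp [loopedPathPoly]
  · rw [show n - 2 = p + p' by omega, show n - 1 = p + p' + 1 by omega]
    simp only [e1, e2]
    simp [loopedPathPoly]
    ring
  · simp [loopedPathPoly]
  · simp only [show n - 1 = p + p' + 1 by omega]
    simp only [e2]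
    simp [loopedPathPoly]

/-! ### Resultants and 2-adic obstructions -/

theorem Polynomial.IsMonicOfDegree.exists_eq_prod {p : Polynomial ℂ} {n : ℕ}
    (h : Polynomial.IsMonicOfDegree p n) :
    ∃ r : Fin n → ℂ, p = ∏ i, (Polynomial.X - Polynomial.C (r i)) := by
  have hs := IsAlgClosed.splits p
  have hcard : p.roots.toList.length = n := by
    rw [Multiset.length_toList, ← hs.natDegree_eq_card_roots, h.natDegree_eq]
  subst hcard
  refine ⟨fun i => p.roots.toList.get i, ?_⟩
  conv_lhs => rw [hs.eq_prod_roots_of_monic h.monic, ← Multiset.coe_toList p.roots,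
    Multiset.map_coe, Multiset.prod_coe]
  rw [← List.prod_ofFn]
  congr 1
  apply List.ext_get <;> simp

theorem eval_prod_X_sub_C {m : ℕ} (s : Fin m → ℂ) (x : ℂ) :
    (∏ j, (Polynomial.X - Polynomial.C (s j))).eval x = ∏ j, (x - s j) := by
  simp [Polynomial.eval_prod]

/-- The product is the absolute resultant of consecutive polynomials. Swapping the roles of the two
root sets and using that the recurrence gives `p_{k+2} = -p_k` at roots of `p_{k+1}` lowers the
index, with `c = 0` from then on. -/
theorem norm_prod_eval_loopedPathPoly (q c : ℂ) (k : ℕ) (r : Fin (k + 1) → ℂ)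
    (hr : loopedPathPoly q (k + 1) + Polynomial.C c * loopedPathPoly q k =
      ∏ i, (Polynomial.X - Polynomial.C (r i))) :
    ∏ i, ‖(loopedPathPoly q k).eval (r i)‖ = 1 := by
  induction k generalizing c with
  | zero => simp [loopedPathPoly]
  | succ k ih =>
    obtain ⟨s, hs⟩ := (isMonicOfDegree_loopedPathPoly q (k + 1)).exists_eq_prod
    have h1 := ih 0 s (by simpa using hs)
    rw [← h1]
    have h2 : ∀ j, (loopedPathPoly q (k + 1)).eval (s j) = 0 := by
      intro j
      rw [hs, eval_prod_X_sub_C]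
      exact Finset.prod_eq_zero (Finset.mem_univ j) (sub_self _)
    have h3 : ∀ j, ∏ i, ‖r i - s j‖ = ‖(loopedPathPoly q k).eval (s j)‖ := by
      intro j
      have h4 := congrArg (Polynomial.eval (s j)) hr
      rw [eval_prod_X_sub_C] at h4
      simp only [loopedPathPoly, Polynomial.eval_add, Polynomial.eval_sub, Polynomial.eval_mul,
        Polynomial.eval_X, Polynomial.eval_C, h2, mul_zero, zero_sub, add_zero] at h4
      rw [← norm_neg, h4, norm_prod]
      exact Finset.prod_congr rfl fun i _ => norm_sub_rev _ _
    calc ∏ i, ‖(loopedPathPoly q (k + 1)).eval (r i)‖ = ∏ i, ∏ j, ‖r i - s j‖ := by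
          refine Finset.prod_congr rfl fun i _ => ?_
          rw [hs, eval_prod_X_sub_C, norm_prod]
      _ = ∏ j, ∏ i, ‖r i - s j‖ := Finset.prod_comm
      _ = _ := Finset.prod_congr rfl fun j _ => h3 j

/-- The first equation makes the 2-adic valuation of `D` equal to `m / e`, strictly between 0 and 1,
while `D = 2 / K` has an integer valuation. -/
theorem two_adic_contradiction {D : ℝ} {O K m e : ℕ} (hO : Odd O) (hm : 0 < m) (he : m < e)
    (h1 : D ^ e * O = 2 ^ m) (h2 : D * K = 2) : False := by
  have h3 : O * 2 ^ e = 2 ^ m * K ^ e := by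
    have : (O : ℝ) * 2 ^ e = 2 ^ m * K ^ e := by
      rw [← h1, ← h2, mul_pow]
      ring
    exact_mod_cast this
  rcases Nat.even_or_odd K with ⟨L, rfl⟩ | hK
  · rw [← two_mul, mul_pow, mul_left_comm, mul_comm O] at h3
    have h4 := Nat.eq_of_mul_eq_mul_left (by positivity) h3
    have h5 : Even O := by
      rw [h4]
      exact (even_two.pow_of_ne_zero hm.ne').mul_right _
    exact (Nat.not_even_iff_odd.2 hO) h5
  · have h4 : 2 ^ e ∣ 2 ^ m * K ^ e := ⟨O, by rw [← h3, mul_comm]⟩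
    have h5 : Nat.Coprime (2 ^ e) (K ^ e) := (Nat.coprime_two_left.2 hK).pow _ _
    have h6 := (Nat.pow_dvd_pow_iff_le_right (by norm_num)).1 (h5.dvd_of_dvd_mul_right h4)
    omega

theorem norm_prod_prod_of_odd_multiples {m n : ℕ} {r : Fin m → ℂ} {s : Fin n → ℂ} {δ : ℂ}
    (h : ∀ i j, ∃ k : ℤ, r i - s j = δ * (2 * k + 1)) :
    ∃ O : ℕ, Odd O ∧ ∏ i, ∏ j, ‖r i - s j‖ = ‖δ‖ ^ (m * n) * O := by
  choose k hk using h
  refine ⟨∏ i, ∏ j, (2 * k i j + 1).natAbs, ?_, ?_⟩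
  · refine Finset.prod_induction _ Odd (fun _ _ => Odd.mul) odd_one fun i _ =>
      Finset.prod_induction _ Odd (fun _ _ => Odd.mul) odd_one fun j _ =>
        Int.natAbs_odd.2 ⟨_, rfl⟩
  · push_cast
    simp only [hk, norm_mul]
    simp only [Finset.prod_mul_distrib, Finset.prod_const, Finset.card_univ, Fintype.card_fin]
    rw [← pow_mul, mul_comm n m]
    congr 1
    refine Finset.prod_congr rfl fun i _ => Finset.prod_congr rfl fun j _ => ?_
    rw [Nat.cast_natAbs, Int.cast_abs, ← Complex.norm_intCast]
    push_cast
    rfl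

/-- The coefficient is, up to sign, an elementary symmetric function, homogeneous of degree `d` in
the roots. -/
theorem prod_X_sub_C_mul_coeff {n d : ℕ} (hd : d ≤ n) (δ : ℂ) (a : Fin n → ℤ) :
    ∃ z : ℤ, (∏ i, (Polynomial.X - Polynomial.C (δ * a i))).coeff (n - d) = δ ^ d * z := by
  have h : ∀ i, Polynomial.X - Polynomial.C (δ * (a i : ℂ)) =
      Polynomial.X + Polynomial.C (δ * ((-a i : ℤ) : ℂ)) := by
    intro i
    simp [sub_eq_add_neg]
  refine ⟨∑ t ∈ (Finset.univ : Finset (Fin n)).powersetCard d, ∏ i ∈ t, -a i, ?_⟩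
  simp only [h]
  rw [Finset.prod_X_add_C_coeff _ _ (by simp)]
  simp only [Finset.card_univ, Fintype.card_fin, Nat.sub_sub_self hd]
  push_cast
  rw [Finset.mul_sum]
  refine Finset.sum_congr rfl fun t ht => ?_
  rw [Finset.prod_mul_distrib, Finset.prod_const, (Finset.mem_powersetCard.1 ht).2]

theorem sum_eq_neg_coeff {n : ℕ} (r : Fin (n + 1) → ℂ) :
    ∑ i, r i = -(∏ i, (Polynomial.X - Polynomial.C (r i))).coeff n := by
  have := Polynomial.prod_X_sub_C_coeff_card_pred Finset.univ r (by simp)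
  simp only [Finset.card_univ, Fintype.card_fin, Nat.add_sub_cancel] at this
  rw [this, neg_neg]

theorem loopedPathPoly_no_odd_multiples_even {q δ : ℂ} {m : ℕ} {r s : Fin (m + 2) → ℂ}
    (hr : loopedPathPoly q (m + 2) - loopedPathPoly q (m + 1) =
      ∏ i, (Polynomial.X - Polynomial.C (r i)))
    (hs : loopedPathPoly q (m + 2) + loopedPathPoly q (m + 1) =
      ∏ i, (Polynomial.X - Polynomial.C (s i)))
    (h : ∀ i j, ∃ k : ℤ, r i - s j = δ * (2 * k + 1)) : False := by
  obtain ⟨O, hO, hprod⟩ := norm_prod_prod_of_odd_multiples h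
  have h1 : ∏ i, ∏ j, ‖r i - s j‖ = 2 ^ (m + 2) := by
    have hi : ∀ i, ∏ j, ‖r i - s j‖ = 2 * ‖(loopedPathPoly q (m + 1)).eval (r i)‖ := by
      intro i
      rw [← norm_prod, ← eval_prod_X_sub_C, ← hs]
      have h0 : (loopedPathPoly q (m + 2) - loopedPathPoly q (m + 1)).eval (r i) = 0 := by
        rw [hr, eval_prod_X_sub_C]
        exact Finset.prod_eq_zero (Finset.mem_univ i) (sub_self _)
      rw [Polynomial.eval_sub, sub_eq_zero] at h0
      rw [Polynomial.eval_add, h0, ← two_mul, norm_mul, Complex.norm_two]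
    rw [Finset.prod_congr rfl fun i _ => hi i, Finset.prod_mul_distrib,
      norm_prod_eval_loopedPathPoly q (-1) (m + 1) r (by rw [← hr]; simp [sub_eq_add_neg])]
    simp
  -- The two polynomials differ by twice a monic polynomial of degree one less.
  have h2 : ∑ i, r i - ∑ i, s i = 2 := by
    have hc : (loopedPathPoly q (m + 1)).coeff (m + 1) = 1 :=
      ((Polynomial.isMonicOfDegree_iff _ _).1 (isMonicOfDegree_loopedPathPoly q (m + 1))).2
    rw [sum_eq_neg_coeff r, sum_eq_neg_coeff s, ← hr, ← hs, Polynomial.coeff_sub,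
      Polynomial.coeff_add, hc]
    ring
  choose k hk using h
  rw [← Finset.sum_sub_distrib, Finset.sum_congr rfl fun i _ => hk i i, ← Finset.mul_sum] at h2
  refine two_adic_contradiction (D := ‖δ‖) (K := (∑ i, (2 * k i i + 1)).natAbs) hO
    (Nat.succ_pos (m + 1)) (e := (m + 2) * (m + 2)) (by nlinarith) (by rw [← hprod, h1]) ?_
  rw [Nat.cast_natAbs, Int.cast_abs, ← Complex.norm_intCast, ← norm_mul]
  push_cast
  rw [h2, Complex.norm_two]

theorem loopedPathPoly_no_odd_multiples_odd {q δ : ℂ} {m : ℕ} {r : Fin (m + 3) → ℂ}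
    {s : Fin (m + 2) → ℂ}
    (hr : loopedPathPoly q (m + 3) - loopedPathPoly q (m + 1) =
      ∏ i, (Polynomial.X - Polynomial.C (r i)))
    (hs : loopedPathPoly q (m + 2) = ∏ i, (Polynomial.X - Polynomial.C (s i)))
    (h : ∀ i j, ∃ k : ℤ, r i - s j = δ * (2 * k + 1)) : False := by
  obtain ⟨O, hO, hprod⟩ := norm_prod_prod_of_odd_multiples h
  have hr' : Polynomial.X * loopedPathPoly q (m + 2) -
      Polynomial.C 2 * loopedPathPoly q (m + 1) = ∏ i, (Polynomial.X - Polynomial.C (r i)) := by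
    rw [← hr, show loopedPathPoly q (m + 3) = Polynomial.X * loopedPathPoly q (m + 2) -
      loopedPathPoly q (m + 1) from rfl, map_ofNat]
    ring
  have h1 : ∏ i, ∏ j, ‖r i - s j‖ = 2 ^ (m + 2) := by
    have hj : ∀ j, ∏ i, ‖r i - s j‖ = 2 * ‖(loopedPathPoly q (m + 1)).eval (s j)‖ := by
      intro j
      have h0 : (loopedPathPoly q (m + 2)).eval (s j) = 0 := by
        rw [hs, eval_prod_X_sub_C]
        exact Finset.prod_eq_zero (Finset.mem_univ j) (sub_self _)
      rw [Finset.prod_congr rfl fun i _ => norm_sub_rev (r i) (s j),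
        ← norm_prod, ← eval_prod_X_sub_C, ← hr']
      simp [h0]
    rw [Finset.prod_comm, Finset.prod_congr rfl fun j _ => hj j, Finset.prod_mul_distrib,
      norm_prod_eval_loopedPathPoly q 0 (m + 1) s (by rw [← hs]; simp)]
    simp
  have hdeg := (Polynomial.isMonicOfDegree_iff _ _).1 (isMonicOfDegree_loopedPathPoly q (m + 1))
  have h2 : ∑ i, r i = ∑ i, s i := by
    have hc : (loopedPathPoly q (m + 1)).coeff (m + 2) = 0 :=
      Polynomial.coeff_eq_zero_of_natDegree_lt (by omega)
    rw [sum_eq_neg_coeff r, sum_eq_neg_coeff s, ← hr', ← hs, Polynomial.coeff_sub,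
      Polynomial.coeff_C_mul, hc, Polynomial.coeff_X_mul]
    ring
  choose k hk using h
  have hs0 : ∀ j, s j = r 0 - δ * (2 * k 0 j + 1) := fun j => by rw [← hk]; ring
  have hr0 : ∀ i, r i = r 0 + δ * (2 * (k i 0 - k 0 0)) := fun i => by
    linear_combination hk i 0 - hk 0 0
  -- There is one more `r` than `s`, so after writing every root relative to `r 0`, equality of the
  -- sums leaves exactly one copy of `r 0`.
  obtain ⟨c, hc⟩ : ∃ c : ℤ, r 0 = δ * c := by
    refine ⟨-(∑ i, 2 * (k i 0 - k 0 0)) - ∑ j, (2 * k 0 j + 1), ?_⟩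
    rw [Finset.sum_congr rfl fun i _ => hr0 i, Finset.sum_congr rfl fun j _ => hs0 j,
      Finset.sum_add_distrib, Finset.sum_sub_distrib, ← Finset.mul_sum, ← Finset.mul_sum] at h2
    simp only [Finset.sum_const, Finset.card_univ, Fintype.card_fin, nsmul_eq_mul] at h2
    push_cast at h2 ⊢
    simp only [← Finset.mul_sum] at h2 ⊢
    linear_combination h2
  have hrz : ∀ i, r i = δ * ((c + 2 * (k i 0 - k 0 0) : ℤ) : ℂ) := fun i => by
    rw [hr0, hc]
    push_cast
    ring
  have hsz : ∀ j, s j = δ * ((c - (2 * k 0 j + 1) : ℤ) : ℂ) := fun j => by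
    rw [hs0, hc]
    push_cast
    ring
  obtain ⟨z, hz⟩ := prod_X_sub_C_mul_coeff (n := m + 3) (d := 2) (by omega) δ
    (fun i => c + 2 * (k i 0 - k 0 0))
  obtain ⟨w, hw⟩ := prod_X_sub_C_mul_coeff (n := m + 2) (d := 2) (by omega) δ
    (fun j => c - (2 * k 0 j + 1))
  simp only [← hrz, ← hr'] at hz
  simp only [← hsz, ← hs] at hw
  rw [show m + 3 - 2 = m + 1 by omega, Polynomial.coeff_sub, Polynomial.coeff_C_mul, hdeg.2,
    Polynomial.coeff_X_mul] at hz
  rw [show m + 2 - 2 = m by omega] at hw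
  -- The second subleading coefficients differ by 2 because of the term `-2 p_{m+1}` in `hr'`.
  have h3 : δ ^ 2 * ((w - z : ℤ) : ℂ) = 2 := by
    push_cast
    linear_combination hz - hw
  -- The number of differences is even, so their product is a power of `δ²` times an odd integer.
  obtain ⟨e, he⟩ := Nat.even_mul_succ_self (m + 2)
  refine two_adic_contradiction (D := ‖δ‖ ^ 2) (K := (w - z).natAbs) hO
    (Nat.succ_pos (m + 1)) (e := e) (by nlinarith) ?_ ?_
  · rw [← pow_mul, show 2 * e = (m + 3) * (m + 2) by rw [two_mul, ← he]; ring, ← hprod, h1]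
  · rw [Nat.cast_natAbs, Int.cast_abs, ← Complex.norm_intCast, ← norm_pow, ← norm_mul, h3, Complex.norm_two]

/-! ### No transfer on four or more vertices -/

theorem exists_odd_multiple_of_exp_eq {q τ : ℝ} (hq : q ≠ 0) (hτ : 0 < τ) {θ η : ℂ}
    (h : Complex.exp (Complex.I * τ * ((1 + (q : ℂ) ^ 2 - q * θ) - (1 + (q : ℂ) ^ 2 - q * η))) =
      -1) : ∃ k : ℤ, θ - η = (-(π / (τ * q)) : ℂ) * (2 * k + 1) := by
  rw [← Complex.exp_pi_mul_I, Complex.exp_eq_exp_iff_exists_int] at h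
  obtain ⟨k, hk⟩ := h
  refine ⟨k, ?_⟩
  have h1 : (τ : ℂ) ≠ 0 := by exact_mod_cast hτ.ne'
  have h2 : (q : ℂ) ≠ 0 := by exact_mod_cast hq
  have h3 : (τ : ℂ) * q * (θ - η) = -(π * (2 * k + 1)) := by
    apply mul_left_cancel₀ Complex.I_ne_zero
    linear_combination -hk
  field_simp
  linear_combination h3

theorem not_isVertexPST_pathGraph {n : ℕ} (hn : 4 ≤ n) {q τ : ℝ} (hq : q ≠ 0) :
    ¬ IsVertexPST (SimpleGraph.pathGraph n) q ⟨0, by omega⟩ ⟨n - 1, by omega⟩ τ := by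
  intro h
  have key : ∀ θ η : ℂ,
      (∃ p p' : ℕ, p + p' + 2 = n ∧
        (loopedPathPoly q p).eval θ = 1 * (loopedPathPoly q (p' + 1)).eval θ ∧
        (loopedPathPoly q (p + 1)).eval θ = 1 * (loopedPathPoly q p').eval θ) →
      (∃ p p' : ℕ, p + p' + 2 = n ∧
        (loopedPathPoly q p).eval η = -1 * (loopedPathPoly q (p' + 1)).eval η ∧
        (loopedPathPoly q (p + 1)).eval η = -1 * (loopedPathPoly q p').eval η) →
      ∃ k : ℤ, θ - η = (-(π / (τ * q)) : ℂ) * (2 * k + 1) := by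
    rintro θ η ⟨p, p', hp, h1, h2⟩ ⟨t, t', ht, h3, h4⟩
    obtain ⟨v, hv, hva, hvb⟩ := exists_eigenvector_of_reflect hp h1 h2
    obtain ⟨w, hw, hwa, hwb⟩ := exists_eigenvector_of_reflect ht h3 h4
    exact exists_odd_multiple_of_exp_eq hq h.1
      (IsPST.exp_eq_neg_one (qLaplacian_isSymm _ _) h hv hw hva hvb hwa hwb)
  have root : ∀ {d : ℕ} (u : Fin d → ℂ) (i : Fin d),
      (∏ i, (Polynomial.X - Polynomial.C (u i))).eval (u i) = 0 := by
    intro d u i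
    rw [eval_prod_X_sub_C]
    exact Finset.prod_eq_zero (Finset.mem_univ i) (sub_self _)
  rcases Nat.even_or_odd' n with ⟨m, rfl | rfl⟩
  · obtain ⟨m, rfl⟩ : ∃ l, m = l + 2 := ⟨m - 2, by omega⟩
    have hd : (loopedPathPoly q (m + 1)).natDegree < m + 2 := by
      rw [(isMonicOfDegree_loopedPathPoly q (m + 1)).natDegree_eq]
      omega
    obtain ⟨r, hr⟩ := ((isMonicOfDegree_loopedPathPoly q (m + 2)).sub hd).exists_eq_prod
    obtain ⟨s, hs⟩ := ((isMonicOfDegree_loopedPathPoly q (m + 2)).add_right hd).exists_eq_prod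
    refine loopedPathPoly_no_odd_multiples_even hr hs fun i j =>
      key _ _ ⟨m + 1, m + 1, by ring, ?_⟩ ⟨m + 1, m + 1, by ring, ?_⟩
    · have := root r i
      rw [← hr, Polynomial.eval_sub] at this
      exact ⟨by linear_combination -this, by linear_combination this⟩
    · have := root s j
      rw [← hs, Polynomial.eval_add] at this
      constructor <;> linear_combination this
  · obtain ⟨m, rfl⟩ : ∃ l, m = l + 2 := ⟨m - 2, by omega⟩
    have hd : (loopedPathPoly q (m + 1)).natDegree < m + 3 := by
      rw [(isMonicOfDegree_loopedPathPoly q (m + 1)).natDegree_eq]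
      omega
    obtain ⟨r, hr⟩ := ((isMonicOfDegree_loopedPathPoly q (m + 3)).sub hd).exists_eq_prod
    obtain ⟨s, hs⟩ := (isMonicOfDegree_loopedPathPoly q (m + 2)).exists_eq_prod
    -- With a central vertex, symmetry only requires its two neighbours to agree, and antisymmetry
    -- only requires the central entry to vanish.
    refine loopedPathPoly_no_odd_multiples_odd hr hs fun i j =>
      key _ _ ⟨m + 2, m + 1, by ring, ?_⟩ ⟨m + 2, m + 1, by ring, ?_⟩
    · have := root r i
      rw [← hr, Polynomial.eval_sub] at this
      exact ⟨by ring, by linear_combination this⟩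
    · have := root s j
      rw [← hs] at this
      refine ⟨by linear_combination 2 * this, ?_⟩
      rw [loopedPathPoly, Polynomial.eval_sub, Polynomial.eval_mul, this]
      ring

/-! ### Paths on two and three vertices -/

theorem exp_I_mul_eq_neg_one_iff (x : ℝ) :
    Complex.exp (Complex.I * x) = -1 ↔ ∃ k : ℤ, x = π * (2 * k + 1) := by
  rw [← Complex.exp_pi_mul_I, Complex.exp_eq_exp_iff_exists_int]
  refine exists_congr fun k => ?_
  constructor
  · intro h
    have : (x : ℂ) = ((π * (2 * k + 1) : ℝ) : ℂ) := by
      apply mul_left_cancel₀ Complex.I_ne_zero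
      push_cast
      linear_combination h
    exact_mod_cast this
  · rintro rfl
    push_cast
    ring

theorem isVertexPST_pathGraph_two {q : ℝ} (hq : q ≠ 0) :
    IsVertexPST (SimpleGraph.pathGraph 2) q 0 1 (π / (2 * |q|)) := by
  have hτ : 0 < π / (2 * |q|) := by positivity
  have heig : ∀ ε : ℂ, ε ^ 2 = 1 →
      (qLaplacian (SimpleGraph.pathGraph 2) q).map (fun r : ℝ => (r : ℂ)) *ᵥ
        (fun i : Fin 2 => 1 / 2 * ε ^ (i : ℕ)) =
          (1 + (q : ℂ) ^ 2 - q * (q + ε)) • (fun i : Fin 2 => 1 / 2 * ε ^ (i : ℕ)) := by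
    intro ε hε
    refine qLaplacian_pathGraph_mulVec le_rfl q (fun k => 1 / 2 * ε ^ k) _ ?_ ?_ ?_
    · ring
    · intro k hk
      omega
    · simp only [Nat.sub_self, show 2 - 1 = 1 from rfl]
      linear_combination (-1 / 2) * hε
  have hexp : Complex.exp (Complex.I * ((2 * (π / (2 * |q|)) * q : ℝ) : ℂ)) = -1 := by
    rw [exp_I_mul_eq_neg_one_iff]
    rcases abs_cases q with ⟨h, _⟩ | ⟨h, _⟩
    · refine ⟨0, ?_⟩
      rw [h]
      field_simp
      norm_num
    · refine ⟨-1, ?_⟩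
      rw [h]
      field_simp
      norm_num
  set τ := π / (2 * |q|)
  refine isPST_of_eigenvectors (qLaplacian_isSymm _ _) hτ
    (![fun i => 1 / 2 * 1 ^ (i : ℕ), fun i => 1 / 2 * (-1) ^ (i : ℕ)] : Fin 2 → Fin 2 → ℂ)
    ![1 + (q : ℂ) ^ 2 - q * (q + 1), 1 + (q : ℂ) ^ 2 - q * (q + -1)] ![1, -1]
    (Complex.exp (Complex.I * τ * (1 + (q : ℂ) ^ 2 - q * (q + 1)))) (Complex.exp_ne_zero _)
    ?_ ?_ ?_ ?_ ?_
  · rw [Fin.forall_fin_two]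
    exact ⟨heig 1 (by norm_num), heig (-1) (by norm_num)⟩
  · rw [Fin.forall_fin_two]
    norm_num
  · rw [Fin.forall_fin_two]
    refine ⟨by simp, ?_⟩
    simp only [cons_val_one, cons_val_fin_one]
    have h : Complex.I * τ * (1 + (q : ℂ) ^ 2 - q * (q + -1)) =
        Complex.I * τ * (1 + (q : ℂ) ^ 2 - q * (q + 1)) + Complex.I * ((2 * τ * q : ℝ) : ℂ) := by
      push_cast
      ring
    rw [h, Complex.exp_add, hexp]
  · funext i
    revert i
    rw [Fin.forall_fin_two]
    norm_num [Fin.sum_univ_two]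
  · funext i
    revert i
    rw [Fin.forall_fin_two]
    norm_num [Fin.sum_univ_two]

theorem qLaplacian_pathGraph_three_mulVec_symm (q : ℝ) {θ : ℂ} (hθ : θ * (θ - q) = 2) (c : ℂ) :
    (qLaplacian (SimpleGraph.pathGraph 3) q).map (fun r : ℝ => (r : ℂ)) *ᵥ
        (fun i : Fin 3 => c * if (i : ℕ) = 1 then θ - q else 1) =
      (1 + (q : ℂ) ^ 2 - q * θ) • (fun i : Fin 3 => c * if (i : ℕ) = 1 then θ - q else 1) := by
  refine qLaplacian_pathGraph_mulVec (by norm_num) q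
    (fun k => c * if k = 1 then θ - q else 1) θ ?_ ?_ ?_
  · simp
    ring
  · intro k hk
    obtain rfl : k = 0 := by omega
    simp
    linear_combination -c * hθ
  · simp
    ring

theorem qLaplacian_pathGraph_three_mulVec_antisymm (q : ℝ) (c : ℂ) :
    (qLaplacian (SimpleGraph.pathGraph 3) q).map (fun r : ℝ => (r : ℂ)) *ᵥ
        (fun i : Fin 3 => c * (1 - (i : ℕ))) =
      (1 + (q : ℂ) ^ 2 - q * q) • (fun i : Fin 3 => c * (1 - (i : ℕ))) := by
  refine qLaplacian_pathGraph_mulVec (by norm_num) q (fun k => c * (1 - k)) q ?_ ?_ ?_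
  · simp
  · intro k hk
    obtain rfl : k = 0 := by omega
    norm_num
  · simp

theorem isVertexPST_pathGraph_three_iff_exp {q τ s : ℝ} (hs : 0 < s) (hs2 : s ^ 2 = q ^ 2 + 8) :
    IsVertexPST (SimpleGraph.pathGraph 3) q 0 2 τ ↔
      0 < τ ∧ Complex.exp (Complex.I * (τ * (q ^ 2 + q * s) / 2 : ℝ)) = -1 ∧
        Complex.exp (Complex.I * (τ * (q ^ 2 - q * s) / 2 : ℝ)) = -1 := by
  have hsC : (s : ℂ) ^ 2 = (q : ℂ) ^ 2 + 8 := by exact_mod_cast hs2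
  have hs0 : (s : ℂ) ≠ 0 := by exact_mod_cast hs.ne'
  have hp : (((q + s) / 2 : ℂ)) * ((q + s) / 2 - q) = 2 := by linear_combination hsC / 4
  have hm : (((q - s) / 2 : ℂ)) * ((q - s) / 2 - q) = 2 := by linear_combination hsC / 4
  constructor
  · intro h
    have key : ∀ θ : ℂ, θ * (θ - q) = 2 → Complex.exp (Complex.I * τ *
        ((1 + (q : ℂ) ^ 2 - q * θ) - (1 + (q : ℂ) ^ 2 - q * q))) = -1 := fun θ hθ =>
      IsPST.exp_eq_neg_one (qLaplacian_isSymm _ _) h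
        (qLaplacian_pathGraph_three_mulVec_symm q hθ 1)
        (qLaplacian_pathGraph_three_mulVec_antisymm q 1) (by simp) (by simp) (by simp)
        (by norm_num)
    refine ⟨h.1, ?_, ?_⟩
    · rw [← key _ hm]
      congr 1
      push_cast
      ring
    · rw [← key _ hp]
      congr 1
      push_cast
      ring
  · rintro ⟨hτ, h1, h2⟩
    -- The weights `(1 ± q/s)/4` make the middle entries of the two symmetric vectors cancel.
    refine isPST_of_eigenvectors (qLaplacian_isSymm _ _) hτ
      (![fun i => 1 / 2 * (1 - (i : ℕ)),
        fun i => (1 + q / s) / 4 * if (i : ℕ) = 1 then ((q : ℂ) + s) / 2 - q else 1,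
        fun i => (1 - q / s) / 4 * if (i : ℕ) = 1 then ((q : ℂ) - s) / 2 - q else 1] :
          Fin 3 → Fin 3 → ℂ)
      ![1 + (q : ℂ) ^ 2 - q * q, 1 + (q : ℂ) ^ 2 - q * ((q + s) / 2),
        1 + (q : ℂ) ^ 2 - q * ((q - s) / 2)] ![-1, 1, 1]
      (-Complex.exp (Complex.I * τ * (1 + (q : ℂ) ^ 2 - q * q)))
      (neg_ne_zero.2 (Complex.exp_ne_zero _)) ?_ ?_ ?_ ?_ ?_
    · simp only [Fin.forall_fin_succ, IsEmpty.forall_iff, and_true]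
      exact ⟨qLaplacian_pathGraph_three_mulVec_antisymm q _,
        qLaplacian_pathGraph_three_mulVec_symm q hp _,
        qLaplacian_pathGraph_three_mulVec_symm q hm _⟩
    · simp [Fin.forall_fin_succ]
    · simp only [Fin.forall_fin_succ, IsEmpty.forall_iff, and_true, cons_val_zero, cons_val_succ,
        mul_neg, neg_neg, mul_one]
      rw [neg_eq_neg_one_mul]
      refine ⟨trivial, ?_, ?_⟩
      · rw [← h2, ← Complex.exp_add]
        congr 1
        push_cast
        ring
      · rw [← h1, ← Complex.exp_add]
        congr 1
        push_cast
        ring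
    · funext i
      revert i
      simp only [Fin.forall_fin_succ, IsEmpty.forall_iff, and_true]
      simp [Fin.sum_univ_three]
      refine ⟨?_, ?_, ?_⟩ <;> field_simp <;> ring
    · funext i
      revert i
      simp only [Fin.forall_fin_succ, IsEmpty.forall_iff, and_true]
      simp [Fin.sum_univ_three]
      refine ⟨?_, ?_, ?_⟩ <;> field_simp <;> ring

/-- Changing the sign of `r` swaps the two conditions, so either square root serves. -/
theorem isVertexPST_pathGraph_three_iff_exists_int {q τ r : ℝ}
    (hr2 : r ^ 2 = q ^ 4 + 8 * q ^ 2) :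
    IsVertexPST (SimpleGraph.pathGraph 3) q 0 2 τ ↔
      0 < τ ∧ (∃ a : ℤ, τ * (q ^ 2 + r) / 2 = π * (2 * a + 1)) ∧
        ∃ b : ℤ, τ * (q ^ 2 - r) / 2 = π * (2 * b + 1) := by
  have hs : 0 < √(q ^ 2 + 8) := by positivity
  have hs2 : √(q ^ 2 + 8) ^ 2 = q ^ 2 + 8 := Real.sq_sqrt (by positivity)
  rw [isVertexPST_pathGraph_three_iff_exp hs hs2, exp_I_mul_eq_neg_one_iff,
    exp_I_mul_eq_neg_one_iff]
  have h : (q * √(q ^ 2 + 8)) ^ 2 = r ^ 2 := by rw [mul_pow, hs2, hr2]; ring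
  rcases sq_eq_sq_iff_eq_or_eq_neg.1 h with h | h
  · rw [h]
  · rw [h, sub_neg_eq_add, ← sub_eq_add_neg, and_comm (a := ∃ k : ℤ, τ * (q ^ 2 - r) / 2 = _)]

theorem isVertexPST_pathGraph_three_iff {q τ : ℝ} (hq : q ≠ 0) :
    IsVertexPST (SimpleGraph.pathGraph 3) q 0 2 τ ↔
      ∃ k l : ℤ, 0 < l ∧ l < k ∧ ¬ k ≡ l [ZMOD 2] ∧
        |q| = √(8 * (l : ℝ) ^ 2 / ((k : ℝ) ^ 2 - (l : ℝ) ^ 2)) ∧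
        τ = π * ((k : ℝ) ^ 2 - (l : ℝ) ^ 2) / (4 * (l : ℝ)) := by
  have hq2 : 0 < q ^ 2 := by positivity
  constructor
  · intro h
    have hr : 0 < √(q ^ 4 + 8 * q ^ 2) := by positivity
    have hr2 : √(q ^ 4 + 8 * q ^ 2) ^ 2 = q ^ 4 + 8 * q ^ 2 := Real.sq_sqrt (by positivity)
    obtain ⟨hτ, ⟨a, ha⟩, ⟨b, hb⟩⟩ := (isVertexPST_pathGraph_three_iff_exists_int hr2).1 h
    set r := √(q ^ 4 + 8 * q ^ 2)
    -- The integers `l` and `k` are the half-sum and half-difference of `2a + 1` and `2b + 1`, hence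
    -- of opposite parity.
    have hl : τ * q ^ 2 = 2 * π * ((a + b + 1 : ℤ) : ℝ) := by
      push_cast
      linear_combination ha + hb
    have hk : τ * r = 2 * π * ((a - b : ℤ) : ℝ) := by
      push_cast
      linear_combination ha - hb
    have hodd : ¬ a - b ≡ a + b + 1 [ZMOD 2] := by
      rw [Int.modEq_iff_dvd]
      omega
    generalize a + b + 1 = l at *
    generalize a - b = k at *
    have hlpos : (0 : ℝ) < l := by
      have : 0 < 2 * π * (l : ℝ) := by rw [← hl]; positivity
      exact (pos_iff_pos_of_mul_pos this).1 (by positivity)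
    have hqr : q ^ 2 < r := by nlinarith
    have hlk : (l : ℝ) < k := by
      have : 2 * π * (l : ℝ) < 2 * π * k := by
        rw [← hl, ← hk]
        exact mul_lt_mul_of_pos_left hqr hτ
      exact lt_of_mul_lt_mul_left this (by positivity)
    have hd : 0 < (k : ℝ) ^ 2 - (l : ℝ) ^ 2 := by nlinarith
    have h1 : π * ((k : ℝ) ^ 2 - (l : ℝ) ^ 2) = 4 * l * τ := by
      have h2 : π * (π * ((k : ℝ) ^ 2 - (l : ℝ) ^ 2)) = π * (4 * l * τ) := by
        have e1 : (τ * r) ^ 2 = (2 * π * k) ^ 2 := by rw [hk]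
        have e2 : (τ * q ^ 2) ^ 2 = (2 * π * l) ^ 2 := by rw [hl]
        linear_combination (-1 / 4) * e1 + (1 / 4) * e2 + τ ^ 2 / 4 * hr2 + 2 * τ * hl
      exact mul_left_cancel₀ pi_ne_zero h2
    refine ⟨k, l, by exact_mod_cast hlpos, by exact_mod_cast hlk, hodd, ?_, ?_⟩
    · rw [← Real.sqrt_sq_eq_abs]
      congr 1
      rw [eq_div_iff hd.ne']
      have h3 : (π * τ) * (q ^ 2 * ((k : ℝ) ^ 2 - (l : ℝ) ^ 2)) = (π * τ) * (8 * l ^ 2) := by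
        linear_combination τ * q ^ 2 * h1 + 4 * l * τ * hl
      exact mul_left_cancel₀ (by positivity) h3
    · rw [eq_div_iff (by positivity), h1]
      ring
  · rintro ⟨k, l, hl, hlk, hodd, hqe, hτe⟩
    have hlpos : (0 : ℝ) < l := by exact_mod_cast hl
    have hlk' : (l : ℝ) < k := by exact_mod_cast hlk
    have hd : 0 < (k : ℝ) ^ 2 - (l : ℝ) ^ 2 := by nlinarith
    have hqs : q ^ 2 * ((k : ℝ) ^ 2 - (l : ℝ) ^ 2) = 8 * l ^ 2 := by
      rw [← sq_abs, hqe, Real.sq_sqrt (by positivity), div_mul_cancel₀ _ hd.ne']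
    have h1 : τ * q ^ 2 = 2 * π * l := by
      rw [hτe]
      field_simp
      linear_combination hqs
    -- This root is forced by `τ q² = 2πl` and `τ r = 2πk`.
    rw [isVertexPST_pathGraph_three_iff_exists_int (r := q ^ 2 * k / l) ?_]
    · have h2 : τ * (q ^ 2 * k / l) = 2 * π * k := by
        rw [← mul_div_assoc, ← mul_assoc, h1]
        field_simp
      rw [Int.modEq_iff_dvd] at hodd
      obtain ⟨a, ha⟩ : ∃ a : ℤ, l + k = 2 * a + 1 := ⟨(l + k - 1) / 2, by omega⟩
      obtain ⟨b, hb⟩ : ∃ b : ℤ, l - k = 2 * b + 1 := ⟨(l - k - 1) / 2, by omega⟩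
      have ha' : (l : ℝ) + k = 2 * a + 1 := by exact_mod_cast ha
      have hb' : (l : ℝ) - k = 2 * b + 1 := by exact_mod_cast hb
      refine ⟨by rw [hτe]; positivity, ⟨a, ?_⟩, ⟨b, ?_⟩⟩
      · linear_combination h1 / 2 + h2 / 2 + π * ha'
      · linear_combination h1 / 2 - h2 / 2 + π * hb'
    · field_simp
      linear_combination hqs

theorem theorem3p9 :
    (∀ (n : ℕ) (hn : 2 ≤ n),
      (∃ q : ℝ, q ≠ 0 ∧ ∃ τ : ℝ,
        IsVertexPST (SimpleGraph.pathGraph n) q ⟨0, by omega⟩ ⟨n - 1, by omega⟩ τ) ↔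
          (n = 2 ∨ n = 3)) ∧
    (∀ q : ℝ, q ≠ 0 → IsVertexPST (SimpleGraph.pathGraph 2) q 0 1 (π / (2 * |q|))) ∧
    (∀ q : ℝ, q ≠ 0 →
      ((∃ τ : ℝ, IsVertexPST (SimpleGraph.pathGraph 3) q 0 2 τ) ↔
        ∃ k l : ℤ, 0 < l ∧ l < k ∧ ¬ k ≡ l [ZMOD 2] ∧
          |q| = √(8 * (l : ℝ) ^ 2 / ((k : ℝ) ^ 2 - (l : ℝ) ^ 2)))) ∧
    (∀ q τ : ℝ, q ≠ 0 →
      (IsVertexPST (SimpleGraph.pathGraph 3) q 0 2 τ ↔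
        ∃ k l : ℤ, 0 < l ∧ l < k ∧ ¬ k ≡ l [ZMOD 2] ∧
          |q| = √(8 * (l : ℝ) ^ 2 / ((k : ℝ) ^ 2 - (l : ℝ) ^ 2)) ∧
          τ = π * ((k : ℝ) ^ 2 - (l : ℝ) ^ 2) / (4 * (l : ℝ)))) := by
  refine ⟨fun n hn => ⟨?_, ?_⟩, fun q hq => isVertexPST_pathGraph_two hq, fun q hq => ?_,
    fun q τ hq => isVertexPST_pathGraph_three_iff hq⟩
  · rintro ⟨q, hq, τ, h⟩
    by_contra hne
    exact not_isVertexPST_pathGraph (by omega) hq h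
  · rintro (rfl | rfl)
    · exact ⟨1, one_ne_zero, _, isVertexPST_pathGraph_two one_ne_zero⟩
    · have hpos : (0 : ℝ) < √(8 * ((1 : ℤ) : ℝ) ^ 2 / (((2 : ℤ) : ℝ) ^ 2 - ((1 : ℤ) : ℝ) ^ 2)) := by
        apply Real.sqrt_pos.2
        norm_num
      exact ⟨_, hpos.ne', _, (isVertexPST_pathGraph_three_iff hpos.ne').2
        ⟨2, 1, by norm_num, by norm_num, by decide, abs_of_pos hpos, rfl⟩⟩
  · constructor
    · rintro ⟨τ, h⟩
      obtain ⟨k, l, hl, hlk, hodd, hqe, -⟩ := (isVertexPST_pathGraph_three_iff hq).1 h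
      exact ⟨k, l, hl, hlk, hodd, hqe⟩
    · rintro ⟨k, l, hl, hlk, hodd, hqe⟩
      exact ⟨_, (isVertexPST_pathGraph_three_iff hq).2 ⟨k, l, hl, hlk, hodd, hqe, rfl⟩⟩
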